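/- **Theorem (Circularity Principle).** *Setting.* Let $\Sigma=(S,\le,F)$ be an order-sorted signature modulo builtins: some sorts are builtin, including $Bool$ with carrier $\{\top,\bot\}$; the builtin symbols form a many-sorted signature interpreted in a fixed builtin model whose elements serve as the builtin constants; all other symbols are constructors, with non-builtin result sorts; no other sort lies below a builtin sort. Let $M^\Sigma$ be the model that extends the builtin model by ground constructor terms over builtin elements, all of whose carriers are non-empty, and let $X$ be an $S$-sorted set of variables with infinitely many variables of each sort. Constraints are first-order formulas with equality over $\Sigma$. A constrained term $\varphi=\langle t\mid\phi\rangle$ denotes $[\![\varphi]\!]=\{\alpha(t) : \alpha:X\to M^\Sigma,\ M^\Sigma,\alpha\models\phi\}$. Let $\mathcal R$ be a set of rules $l\to r\ \mathrm{if}\ \phi_{lr}$ with $l,r$ of a common sort; it defines the relation $\alpha(c[l])\to_{\mathcal R}\alpha(c[r])$ for all rules, contexts $c$ and valuations $\alpha\models\phi_{lr}$. *Satisfaction.* For state predicates $P,Q\subseteq M^\Sigma$ put $\partial(P)=\{\gamma' : \gamma\to_{\mathcal R}\gamma',\ \gamma\in P\}$. Demonic validity of $P\Rightarrow Q$ is defined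 coinductively (greatest fixed point) by two rules: $P\Rightarrow Q$ holds if $P\subseteq Q$; and $P\Rightarrow Q$ follows from $\partial(P\setminus Q)\Rightarrow Q$ if $P\setminus Q$ is non-empty and each of its states has a successor. A reachability formula $\varphi\Rightarrow\varphi'$ is a pair of constrained terms; $\mathcal R\models^\forall\varphi\Rightarrow\varphi'$ means that $[\![\sigma(\varphi)]\!]\Rightarrow[\![\sigma(\varphi')]\!]$ is demonically valid for each $\sigma:var(\varphi)\cap var(\varphi')\to M^\Sigma$. *Derivatives.* A derivative of $\langle t\mid\phi\rangle$ is a constrained term $\langle c[r]\mid\phi\wedge t=c[l]\wedge\phi_{lr}\rangle$ with satisfiable constraint, where $c$ is a context and $(l,r,\phi_{lr})$ is a rule of $\mathcal R$ with variables renamed apart from $var(t,\phi)$. $\Delta_{\mathcal R}(\langle t\mid\phi\rangle)$ stands for any set of derivatives of which every derivative is an instance, i.e. arises by using the same rule and applying to the context and the renamed rule variables a substitution that fixes $var(t,\phi)$ and sends the renamed rule variables to variables. *Proof system.* Let $G$ be a set of reachability formulas. $\mathsf{DCC}(\mathcal R,G)$ has the rules: - [axiom]: $\langle t_l\mid\bot\rangle\Rightarrow\varphi_r$,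 without premises. - [subs]: from $\langle t_l\mid\phi_l\wedge\neg\psi\rangle\Rightarrow\langle t_r\mid\phi_r\rangle$ infer $\langle t_l\mid\phi_l\rangle\Rightarrow\langle t_r\mid\phi_r\rangle$, where $\psi$ is $\exists\tilde x.\,t_l=t_r\wedge\phi_r$, $\tilde x=var(t_r,\phi_r)\setminus var(t_l,\phi_l)$, and $\psi$ is satisfiable. - [der$^\forall$]: from $\langle t^j\mid\phi^j\rangle\Rightarrow\varphi_r$ for all $\langle t^j\mid\phi^j\rangle\in\Delta_{\mathcal R}(\langle t_l\mid\phi_l\rangle)$ infer $\langle t_l\mid\phi_l\rangle\Rightarrow\varphi_r$, provided that there is at least one derivative and that $\phi_l\to\bigvee_j\exists\tilde y^j.\phi^j$ is valid in $M^\Sigma$, where $\tilde y^j=var(t^j,\phi^j)\setminus var(t_l,\phi_l)$. - [circ]: from $\langle t^c_r\mid\phi_l\wedge\psi\wedge\phi^c_r\rangle\Rightarrow\varphi_r$ and $\langle t_l\mid\phi_l\wedge\neg\psi\rangle\Rightarrow\varphi_r$ infer $\langle t_l\mid\phi_l\rangle\Rightarrow\varphi_r$, where $\langle t^c_l\mid\phi^c_l\rangle\Rightarrow\langle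 t^c_r\mid\phi^c_r\rangle$ is a formula of $G$ with variables renamed apart from those of the conclusion and $\psi$ is $\exists var(t^c_l,\phi^c_l).\,t_l=t^c_l\wedge\phi^c_l$. Implicitly, any formula may be replaced by an equivalent one; $\varphi_1\Rightarrow\varphi_1'$ and $\varphi_2\Rightarrow\varphi_2'$ are equivalent if the sets $\{(\gamma,[\![\sigma(\varphi_i')]\!]) : \sigma : var(\varphi_i)\cap var(\varphi_i')\to M^\Sigma,\ \gamma\in[\![\sigma(\varphi_i)]\!]\}$ coincide for $i=1,2$. Proof trees may be finite or infinite, but every infinite branch of a proof tree must contain infinitely many [der$^\forall$] nodes. A proof tree is guarded if each of its [circ] nodes has a [der$^\forall$] node as a proper ancestor. *Claim.* If every formula in $G$ has a guarded proof tree under $\mathsf{DCC}(\mathcal R,G)$, then $\mathcal R\models^\forall\varphi\Rightarrow\varphi'$ for every $\varphi\Rightarrow\varphi'$ in $G$. -/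

import Mathlib

universe u v

namespace LCTRS

/-! ### Order-sorted signatures modulo builtins -/

/-- An order-sorted signature `(S, ≤, F)` modulo builtins, together with the builtin model and the
sorted variables.  The set of sorts is `S = BSort ⊕ CSort` (builtin and non-builtin sorts).

* Builtin symbols form a many-sorted signature (`BOp`), interpreted by `bInterp` in the carriers
  `carrier b`.  The builtin constants are the elements of the carriers.
* Non-builtin symbols (`COp`, the constructors) may be overloaded: `rank f n w s` says that
  `f ∈ F_{w,s}`, where `w` is a word of `n` sorts.  They are interpreted as term constructors, so
  their result sorts are non-builtin.
* No other sort lies below a builtin sort. -/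
structure Signature where
  BSort : Type u
  boolSort : BSort
  carrier : BSort → Type u
  boolEquiv : carrier boolSort ≃ Bool
  BOp : Type u
  bArity : BOp → ℕ
  bDom : (f : BOp) → Fin (bArity f) → BSort
  bCod : BOp → BSort
  bInterp : (f : BOp) → ((i : Fin (bArity f)) → carrier (bDom f i)) → carrier (bCod f)
  CSort : Type u
  le : BSort ⊕ CSort → BSort ⊕ CSort → Prop
  le_refl : ∀ s, le s s
  le_trans : ∀ s₁ s₂ s₃, le s₁ s₂ → le s₂ s₃ → le s₁ s₃
  le_antisymm : ∀ s₁ s₂, le s₁ s₂ → le s₂ s₁ → s₁ = s₂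
  le_builtin : ∀ s b, le s (Sum.inl b) → s = Sum.inl b
  COp : Type u
  rank : COp → (n : ℕ) → (Fin n → BSort ⊕ CSort) → CSort → Prop
  rank_mono : ∀ f n w w' s s', rank f n w s → rank f n w' s' → (∀ i, le (w i) (w' i)) →
    le (Sum.inr s) (Sum.inr s')
  V : Type u
  sortOf : V → BSort ⊕ CSort
  infinite_vars : ∀ s, Infinite {x : V // sortOf x = s}

/-- The set of all sorts. -/
abbrev Signature.Srt (S : Signature.{u}) : Type u := S.BSort ⊕ S.CSort

/-- Elements of the model `M^Σ`: ground constructor terms over builtin elements. -/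
inductive Val (S : Signature.{u}) : Type u
  | elem (b : S.BSort) (a : S.carrier b) : Val S
  | app (f : S.COp) (n : ℕ) (vs : Fin n → Val S) : Val S

/-- `v.HasSort s` means `v ∈ M^Σ_s`.  For a builtin sort `b` these are exactly the elements of
`carrier b`; for a non-builtin sort they are the ground constructor terms of that sort. -/
inductive Val.HasSort {S : Signature.{u}} : Val S → S.Srt → Prop
  | elem (b : S.BSort) (a : S.carrier b) (s : S.Srt) (h : S.le (Sum.inl b) s) :
      Val.HasSort (Val.elem b a) s
  | app (f : S.COp) (n : ℕ) (vs : Fin n → Val S) (w : Fin n → S.Srt) (s' : S.CSort) (s : S.Srt)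
      (hr : S.rank f n w s') (hv : ∀ i, Val.HasSort (vs i) (w i)) (h : S.le (Sum.inr s') s) :
      Val.HasSort (Val.app f n vs) s

/-! ### Terms -/

/-- Raw terms over `Σ` with variables from `X`. -/
inductive Term (S : Signature.{u}) (X : Type u) : Type u
  | var (x : X) : Term S X
  | elem (b : S.BSort) (a : S.carrier b) : Term S X
  | bapp (f : S.BOp) (ts : Fin (S.bArity f) → Term S X) : Term S X
  | capp (f : S.COp) (n : ℕ) (ts : Fin n → Term S X) : Term S X

variable {S : Signature.{u}} {X Y : Type u}

/-- `t.HasSort srt s` means `t ∈ T_{Σ,s}(X)`, where the variable `x` has sort `srt x`. -/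
inductive Term.HasSort (srt : X → S.Srt) : Term S X → S.Srt → Prop
  | var (x : X) (s : S.Srt) (h : S.le (srt x) s) : Term.HasSort srt (Term.var x) s
  | elem (b : S.BSort) (a : S.carrier b) (s : S.Srt) (h : S.le (Sum.inl b) s) :
      Term.HasSort srt (Term.elem b a) s
  | bapp (f : S.BOp) (ts : Fin (S.bArity f) → Term S X) (s : S.Srt)
      (ht : ∀ i, Term.HasSort srt (ts i) (Sum.inl (S.bDom f i)))
      (h : S.le (Sum.inl (S.bCod f)) s) : Term.HasSort srt (Term.bapp f ts) s
  | capp (f : S.COp) (n : ℕ) (ts : Fin n → Term S X) (w : Fin n → S.Srt) (s' : S.CSort)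
      (s : S.Srt) (hr : S.rank f n w s') (ht : ∀ i, Term.HasSort srt (ts i) (w i))
      (h : S.le (Sum.inr s') s) : Term.HasSort srt (Term.capp f n ts) s

/-- The variables of a term. -/
def Term.vars : Term S X → Set X
  | .var x => {x}
  | .elem _ _ => ∅
  | .bapp _ ts => ⋃ i, (ts i).vars
  | .capp _ _ ts => ⋃ i, (ts i).vars

open Classical in
/-- The number of occurrences of the variable `x` in a term. -/
noncomputable def Term.occ (x : X) : Term S X → ℕ
  | .var y => if y = x then 1 else 0
  | .elem _ _ => 0
  | .bapp _ ts => ∑ i, (ts i).occ x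
  | .capp _ _ ts => ∑ i, (ts i).occ x

/-- Simultaneous substitution. -/
def Term.subst (θ : X → Term S Y) : Term S X → Term S Y
  | .var x => θ x
  | .elem b a => .elem b a
  | .bapp f ts => .bapp f (fun i => (ts i).subst θ)
  | .capp f n ts => .capp f n (fun i => (ts i).subst θ)

/-- Renaming of variables. -/
def Term.rename (π : X → Y) (t : Term S X) : Term S Y := t.subst (fun x => .var (π x))

open Classical in
/-- The interpretation of a builtin symbol on model elements; on ill-sorted arguments, which do not
arise from well-sorted terms, the value is arbitrary. -/
noncomputable def bopVal (f : S.BOp) (vs : Fin (S.bArity f) → Val S) : Val S :=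
  if h : ∃ a : (i : Fin (S.bArity f)) → S.carrier (S.bDom f i),
      ∀ i, vs i = Val.elem (S.bDom f i) (a i)
  then Val.elem (S.bCod f) (S.bInterp f h.choose)
  else Val.elem S.boolSort (S.boolEquiv.symm true)

/-- The extension of a valuation to terms. -/
noncomputable def Term.eval (α : X → Val S) : Term S X → Val S
  | .var x => α x
  | .elem b a => .elem b a
  | .bapp f ts => bopVal f (fun i => (ts i).eval α)
  | .capp f n ts => .app f n (fun i => (ts i).eval α)

/-- `α` is a (sort-respecting) valuation `X → M^Σ`. -/
def IsValuation (α : S.V → Val S) : Prop := ∀ x, (α x).HasSort (S.sortOf x)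

/-! ### Contexts -/

/-- A context is a term with a distinguished additional variable, `none`, standing for the hole. -/
abbrev Ctx (S : Signature.{u}) : Type u := Term S (Option S.V)

/-- `c.IsCtx h` : `c` is a well-sorted term with exactly one occurrence of the hole, the hole
having sort `h`. -/
def Term.IsCtx (c : Ctx S) (h : S.Srt) : Prop :=
  c.occ none = 1 ∧ ∃ s, c.HasSort (fun o => o.elim h S.sortOf) s

/-- `c[t]`. -/
def Term.plug (c : Ctx S) (t : Term S S.V) : Term S S.V := c.subst (fun o => o.elim t Term.var)

/-- Application of a substitution to a context; the hole stays fixed. -/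
def Term.substCtx (θ : S.V → Term S S.V) (c : Ctx S) : Ctx S :=
  c.subst (fun o => o.elim (Term.var none) (fun x => (θ x).rename some))

/-! ### Constraint formulas -/

/-- First-order formulas with equality over `Σ`; terms of sort `Bool` are atomic formulas. -/
inductive Formula (S : Signature.{u}) : Type u
  | bot : Formula S
  | eq (t t' : Term S S.V) : Formula S
  | atom (t : Term S S.V) : Formula S
  | neg (φ : Formula S) : Formula S
  | and (φ ψ : Formula S) : Formula S
  | or (φ ψ : Formula S) : Formula S
  | imp (φ ψ : Formula S) : Formula S
  | all (x : S.V) (φ : Formula S) : Formula S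
  | ex (x : S.V) (φ : Formula S) : Formula S

/-- Well-sortedness of formulas. -/
def Formula.WF : Formula S → Prop
  | .bot => True
  | .eq t t' => (∃ s, t.HasSort S.sortOf s) ∧ ∃ s, t'.HasSort S.sortOf s
  | .atom t => t.HasSort S.sortOf (Sum.inl S.boolSort)
  | .neg φ => φ.WF
  | .and φ ψ => φ.WF ∧ ψ.WF
  | .or φ ψ => φ.WF ∧ ψ.WF
  | .imp φ ψ => φ.WF ∧ ψ.WF
  | .all _ φ => φ.WF
  | .ex _ φ => φ.WF

/-- The free variables of a formula. -/
def Formula.fv : Formula S → Set S.V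
  | .bot => ∅
  | .eq t t' => t.vars ∪ t'.vars
  | .atom t => t.vars
  | .neg φ => φ.fv
  | .and φ ψ => φ.fv ∪ ψ.fv
  | .or φ ψ => φ.fv ∪ ψ.fv
  | .imp φ ψ => φ.fv ∪ ψ.fv
  | .all x φ => φ.fv \ {x}
  | .ex x φ => φ.fv \ {x}

/-- Renaming of all variables, free and bound.  It is used only with permutations of the variables,
for which no capture can occur. -/
def Formula.rename (π : S.V → S.V) : Formula S → Formula S
  | .bot => .bot
  | .eq t t' => .eq (t.rename π) (t'.rename π)
  | .atom t => .atom (t.rename π)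
  | .neg φ => .neg (φ.rename π)
  | .and φ ψ => .and (φ.rename π) (ψ.rename π)
  | .or φ ψ => .or (φ.rename π) (ψ.rename π)
  | .imp φ ψ => .imp (φ.rename π) (ψ.rename π)
  | .all x φ => .all (π x) (φ.rename π)
  | .ex x φ => .ex (π x) (φ.rename π)

open Classical in
/-- `M^Σ, α ⊨ φ`. -/
noncomputable def Formula.Sat : (S.V → Val S) → Formula S → Prop
  | _, .bot => False
  | α, .eq t t' => t.eval α = t'.eval α
  | α, .atom t => t.eval α = Val.elem S.boolSort (S.boolEquiv.symm true)
  | α, .neg φ => ¬ φ.Sat α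
  | α, .and φ ψ => φ.Sat α ∧ ψ.Sat α
  | α, .or φ ψ => φ.Sat α ∨ ψ.Sat α
  | α, .imp φ ψ => φ.Sat α → ψ.Sat α
  | α, .all x φ => ∀ v : Val S, v.HasSort (S.sortOf x) → φ.Sat (Function.update α x v)
  | α, .ex x φ => ∃ v : Val S, v.HasSort (S.sortOf x) ∧ φ.Sat (Function.update α x v)

/-- `φ` is satisfiable in `M^Σ`. -/
def Formula.Satisfiable (φ : Formula S) : Prop := ∃ α, IsValuation α ∧ φ.Sat α

/-- `∃ x₁ … xₙ. φ`. -/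
def Formula.exs (xs : List S.V) (φ : Formula S) : Formula S := xs.foldr Formula.ex φ

/-! ### Constrained terms, rewrite systems, reachability formulas -/

/-- A constrained term `⟨t | φ⟩`. -/
structure CTerm (S : Signature.{u}) where
  term : Term S S.V
  form : Formula S
  term_wf : ∃ s, term.HasSort S.sortOf s
  form_wf : form.WF

/-- `var(⟨t | φ⟩)`. -/
def CTerm.vars (φ : CTerm S) : Set S.V := φ.term.vars ∪ φ.form.fv

/-- `⟦σ(⟨t | φ⟩)⟧`, where `σ` instantiates the variables in `A`: the values of `t` under the
valuations that satisfy `φ` and agree with `σ` on `A`. -/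
def CTerm.sem (φ : CTerm S) (A : Set S.V) (σ : S.V → Val S) : Set (Val S) :=
  {γ | ∃ α, IsValuation α ∧ (∀ x ∈ A, α x = σ x) ∧ φ.form.Sat α ∧ γ = φ.term.eval α}

/-- A logically constrained rewrite rule `l → r if φ`, with `l` and `r` of the same sort. -/
structure Rule (S : Signature.{u}) where
  lhs : Term S S.V
  rhs : Term S S.V
  cond : Formula S
  same_sort : ∃ s, lhs.HasSort S.sortOf s ∧ rhs.HasSort S.sortOf s
  cond_wf : cond.WF

/-- `var(l, r, φ)`. -/
def Rule.vars (ρ : Rule S) : Set S.V := ρ.lhs.vars ∪ ρ.rhs.vars ∪ ρ.cond.fv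

/-- `c` is a context into which both sides of the rule can be placed. -/
def Rule.FitsIn (ρ : Rule S) (c : Ctx S) : Prop :=
  ∃ h, ρ.lhs.HasSort S.sortOf h ∧ ρ.rhs.HasSort S.sortOf h ∧ c.IsCtx h

/-- The transition relation on `M^Σ` defined by the system `R`. -/
def Trans (R : Set (Rule S)) (γ γ' : Val S) : Prop :=
  ∃ ρ ∈ R, ∃ c : Ctx S, ρ.FitsIn c ∧ ∃ α, IsValuation α ∧ ρ.cond.Sat α ∧
    γ = (c.plug ρ.lhs).eval α ∧ γ' = (c.plug ρ.rhs).eval α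

/-- A reachability formula `⟨t | φ⟩ ⇒ ⟨t' | φ'⟩`. -/
structure RForm (S : Signature.{u}) where
  lhs : CTerm S
  rhs : CTerm S

/-- All the variables of a reachability formula. -/
def RForm.vars (f : RForm S) : Set S.V := f.lhs.vars ∪ f.rhs.vars

/-- The variables shared by the two sides. -/
def RForm.shared (f : RForm S) : Set S.V := f.lhs.vars ∩ f.rhs.vars

/-! ### Demonic validity, coinductively -/

section Validity

variable {M : Type u} (tr : M → M → Prop)

/-- The derivative `∂(P)` of a state predicate. -/
def deriv (P : Set M) : Set M := {γ' | ∃ γ ∈ P, tr γ γ'}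

/-- Runnable state predicates. -/
def Runnable (P : Set M) : Prop := P.Nonempty ∧ ∀ γ ∈ P, ∃ γ', tr γ γ'

/-- The functional of the two rules: Subsumption (`P ⊆ Q`) and Step (from `∂(P \ Q) ⇒ Q` infer
`P ⇒ Q`, provided `P \ Q` is runnable). -/
def dvp : Set (Set M × Set M) →o Set (Set M × Set M) where
  toFun Z := {p | p.1 ⊆ p.2 ∨ (Runnable tr (p.1 \ p.2) ∧ (deriv tr (p.1 \ p.2), p.2) ∈ Z)}
  monotone' := fun _ _ hZ _ hp => hp.imp id (fun h => ⟨h.1, hZ h.2⟩)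

/-- `(M, →) ⊨∀ P ⇒ Q` : membership in the greatest fixed point of `dvp`. -/
def DemonicallyValid (P Q : Set M) : Prop := (P, Q) ∈ OrderHom.gfp (dvp tr)

end Validity

/-- `R ⊨∀ f` : for every instantiation `σ` of the shared variables, the reachability predicate
`⟦σ(lhs)⟧ ⇒ ⟦σ(rhs)⟧` is demonically valid. -/
def Satisfies (R : Set (Rule S)) (f : RForm S) : Prop :=
  ∀ σ, IsValuation σ →
    DemonicallyValid (Trans R) (f.lhs.sem f.shared σ) (f.rhs.sem f.shared σ)

/-! ### Derivatives of constrained terms -/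

/-- A sort-preserving permutation of the variables. -/
def SortPreserving (π : Equiv.Perm S.V) : Prop := ∀ x, S.sortOf (π x) = S.sortOf x

/-- The data that determine a derivative: a rule, a renaming of its variables, a context. -/
structure DerData (S : Signature.{u}) where
  rule : Rule S
  ren : Equiv.Perm S.V
  ctx : Ctx S

/-- The term `c[r]` of the derivative. -/
def DerData.term (d : DerData S) : Term S S.V := d.ctx.plug (d.rule.rhs.rename d.ren)

/-- The constraint `φ ∧ t = c[l] ∧ φ_lr` of the derivative of `⟨t | φ⟩`. -/
def DerData.form (d : DerData S) (φ : CTerm S) : Formula S :=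
  .and φ.form (.and (.eq φ.term (d.ctx.plug (d.rule.lhs.rename d.ren)))
    (d.rule.cond.rename d.ren))

/-- `d` describes a derivative of `φ` with respect to `R`: the renamed variables of the rule are
disjoint from those of `φ`, and the resulting constraint is satisfiable. -/
def IsDer (R : Set (Rule S)) (φ : CTerm S) (d : DerData S) : Prop :=
  d.rule ∈ R ∧ SortPreserving d.ren ∧ Disjoint (d.ren '' d.rule.vars) φ.vars ∧
    d.rule.FitsIn d.ctx ∧ (d.form φ).Satisfiable

/-- `d'` is an instance of `d`: same rule, and the context and the renamed rule variables of `d'`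
arise from those of `d` by a substitution that fixes the variables of `φ`. -/
def IsInstance (φ : CTerm S) (d d' : DerData S) : Prop :=
  d'.rule = d.rule ∧ ∃ θ : S.V → Term S S.V,
    (∀ x, (θ x).HasSort S.sortOf (S.sortOf x)) ∧ (∀ x ∈ φ.vars, θ x = .var x) ∧
    d'.ctx = d.ctx.substCtx θ ∧ ∀ x ∈ d.rule.vars, θ (d.ren x) = .var (d'.ren x)

/-- `D` is a set of representatives of `Δ_R(φ)`: it consists of derivatives of `φ`, and every
derivative of `φ` (for all fresh renamings and all contexts) is an instance of one in `D`.
The set of all derivatives is one such `D`. -/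
def IsDerSet (R : Set (Rule S)) (φ : CTerm S) (D : Set (DerData S)) : Prop :=
  (∀ d ∈ D, IsDer R φ d) ∧ ∀ d', IsDer R φ d' → ∃ d ∈ D, IsInstance φ d d'

/-! ### The proof system -/

/-- The pairs `(γ, ⟦σ(rhs)⟧)` with `γ ∈ ⟦σ(lhs)⟧`, for all instantiations `σ` of the shared
variables. -/
def RForm.instances (f : RForm S) : Set (Val S × Set (Val S)) :=
  {p | ∃ σ, IsValuation σ ∧ p.1 ∈ f.lhs.sem f.shared σ ∧ p.2 = f.rhs.sem f.shared σ}

/-- The equivalence used by the implicit structural rule: the two formulas state the same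
reachability requirements on the same states. -/
def RForm.Equivalent (f g : RForm S) : Prop := f.instances = g.instances

/-- The names of the proof rules. -/
inductive Kind
  | ax
  | subs
  | der
  | circ

/-- `Inference R G k f Ps` : there is an instance of the proof rule `k` of `DCC(R, G)` with
conclusion `f` and set of premises `Ps`. -/
inductive Inference (R : Set (Rule S)) (G : Set (RForm S)) : Kind → RForm S → Set (RForm S) → Prop
  | ax (f : RForm S) (h : f.lhs.form = .bot) : Inference R G .ax f ∅
  | subs (f p : RForm S) (xs : List S.V) (ψ : Formula S)
      (hxs : ∀ x, x ∈ xs ↔ x ∈ f.rhs.vars \ f.lhs.vars)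
      (hψ : ψ = .exs xs (.and (.eq f.lhs.term f.rhs.term) f.rhs.form))
      (hsat : ψ.Satisfiable)
      (hterm : p.lhs.term = f.lhs.term)
      (hform : p.lhs.form = .and f.lhs.form (.neg ψ))
      (hrhs : p.rhs = f.rhs) : Inference R G .subs f {p}
  | der (f : RForm S) (D : Set (DerData S)) (Ps : Set (RForm S))
      (hD : IsDerSet R f.lhs D)
      (hder : ∃ d, IsDer R f.lhs d)
      -- validity of the implication from `φ_l` to the disjunction of the `∃ ỹʲ. φʲ`
      (htotal : ∀ α, IsValuation α → f.lhs.form.Sat α → ∃ d ∈ D, ∃ β, IsValuation β ∧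
        (∀ x, x ∉ (d.term.vars ∪ (d.form f.lhs).fv) \ f.lhs.vars → β x = α x) ∧
        (d.form f.lhs).Sat β)
      (hprem : ∀ d ∈ D, ∃ p ∈ Ps, p.lhs.term = d.term ∧ p.lhs.form = d.form f.lhs ∧ p.rhs = f.rhs)
      (honly : ∀ p ∈ Ps, ∃ d ∈ D, p.lhs.term = d.term ∧ p.lhs.form = d.form f.lhs ∧
        p.rhs = f.rhs) :
      Inference R G .der f Ps
  | circ (f p q g : RForm S) (π : Equiv.Perm S.V) (xs : List S.V) (ψ : Formula S)
      (hg : g ∈ G) (hπ : SortPreserving π) (hfresh : Disjoint (π '' g.vars) f.vars)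
      (hxs : ∀ x, x ∈ xs ↔ x ∈ π '' g.lhs.vars)
      (hψ : ψ = .exs xs (.and (.eq f.lhs.term (g.lhs.term.rename π)) (g.lhs.form.rename π)))
      (hpterm : p.lhs.term = g.rhs.term.rename π)
      (hpform : p.lhs.form = .and f.lhs.form (.and ψ (g.rhs.form.rename π)))
      (hprhs : p.rhs = f.rhs)
      (hqterm : q.lhs.term = f.lhs.term)
      (hqform : q.lhs.form = .and f.lhs.form (.neg ψ))
      (hqrhs : q.rhs = f.rhs) : Inference R G .circ f {p, q}

/-- A finite or infinite proof tree under `DCC(R, G)`.  Every node carries a reachability formula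
and the name of a proof rule; up to the implicit structural rule, the formula follows from those at
the children by that proof rule. -/
structure ProofTree (R : Set (Rule S)) (G : Set (RForm S)) where
  Node : Type v
  root : Node
  child : Node → Node → Prop
  root_no_parent : ∀ n, ¬ child n root
  unique_parent : ∀ n n' m, child n m → child n' m → n = n'
  reachable : ∀ n, Relation.ReflTransGen child root n
  label : Node → RForm S
  kind : Node → Kind
  inference : ∀ n, ∃ f, (label n).Equivalent f ∧ Inference R G (kind n) f (label '' {m | child n m})
  /-- Every infinite branch passes infinitely often through the derivative rule (which holds
  vacuously for finite trees). -/
  progress : ∀ b : ℕ → Node, (∀ i, child (b i) (b (i + 1))) → ∀ N, ∃ i, N ≤ i ∧ kind (b i) = .der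

/-- Every circularity node has a derivative node as a (proper) ancestor. -/
def ProofTree.Guarded {R : Set (Rule S)} {G : Set (RForm S)} (T : ProofTree.{u, v} R G) : Prop :=
  ∀ n, T.kind n = .circ → ∃ a, Relation.TransGen T.child a n ∧ T.kind a = .der

end LCTRS

namespace LCTRS

variable {S : Signature.{u}} {X Y : Type u}

/-! ### Terms -/

/-! Validity is reduced to single states. A requirement is a pair `(γ, Q)`, read "from `γ`, reach
`Q`"; `RForm.instances` collects those that a formula makes. The requirements of all nodes of all
guarded proof trees are closed under reflexivity and transitivity (`ReachClosure`). It suffices that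
each of them advances: `γ ∈ Q`, or `γ` has successors, and from each of these `Q` is required by the
closure. The closure then advances as well, which gives a post-fixed point of `dvp`
(`demonicallyValid_of_advances`).

`Inference.sound` extracts what each proof rule contributes. Starting at a node, one descends
through nodes other than [der], a well-founded process, until `Q` is hit or a [der] node supplies a
step, whose results are covered by its children. The obstacle is [circ], which appeals to a formula
`g` of `G` that is itself to be proved. But `g` is only asked to advance: if it steps, transitivity
composes the result with the first premise; if `γ` already lies in the target of `g`, the descent
goes on in that premise. That `g` advances is seen at the root of its guarded tree, where no [circ]
node comes before the first [der] node, so nothing circular remains. Hence `advances_of_circ` is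
used twice: for roots, then for arbitrary nodes. -/

theorem Term.eval_congr {α β : X → Val S} (t : Term S X) (h : ∀ x ∈ t.vars, α x = β x) :
    t.eval α = t.eval β := by
  induction t with
  | var x => exact h x rfl
  | elem b a => rfl
  | bapp f ts ih =>
    simp only [Term.eval]
    congr 1
    funext i
    exact ih i fun x hx => h x (Set.mem_iUnion.2 ⟨i, hx⟩)
  | capp f n ts ih =>
    simp only [Term.eval]
    congr 1
    funext i
    exact ih i fun x hx => h x (Set.mem_iUnion.2 ⟨i, hx⟩)

theorem Term.eval_subst (θ : X → Term S Y) (α : Y → Val S) (t : Term S X) :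
    (t.subst θ).eval α = t.eval fun x => (θ x).eval α := by
  induction t with
  | var x => rfl
  | elem b a => rfl
  | bapp f ts ih => simp only [Term.subst, Term.eval, ih]
  | capp f n ts ih => simp only [Term.subst, Term.eval, ih]

theorem Term.eval_rename (π : X → Y) (α : Y → Val S) (t : Term S X) :
    (t.rename π).eval α = t.eval (α ∘ π) :=
  Term.eval_subst _ _ _

theorem Term.vars_rename (π : X → Y) (t : Term S X) : (t.rename π).vars = π '' t.vars := by
  induction t with
  | var x => simp [Term.rename, Term.subst, Term.vars]
  | elem b a => simp [Term.rename, Term.subst, Term.vars]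
  | bapp f ts ih =>
    simp only [Term.rename, Term.subst, Term.vars, Set.image_iUnion] at ih ⊢
    simp only [ih]
  | capp f n ts ih =>
    simp only [Term.rename, Term.subst, Term.vars, Set.image_iUnion] at ih ⊢
    simp only [ih]

theorem Term.finite_vars (t : Term S X) : t.vars.Finite := by
  induction t with
  | var x => exact Set.finite_singleton x
  | elem b a => exact Set.finite_empty
  | bapp f ts ih => exact Set.finite_iUnion ih
  | capp f n ts ih => exact Set.finite_iUnion ih

open Classical in
theorem Term.occ_rename {π : X → Y} (hπ : Function.Injective π) (x : X) (t : Term S X) :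
    (t.rename π).occ (π x) = t.occ x := by
  induction t with
  | var y =>
    simp only [Term.rename, Term.subst, Term.occ]
    exact if_congr hπ.eq_iff rfl rfl
  | elem b a => rfl
  | bapp f ts ih =>
    simp only [Term.rename, Term.subst, Term.occ] at ih ⊢
    simp only [ih]
  | capp f n ts ih =>
    simp only [Term.rename, Term.subst, Term.occ] at ih ⊢
    simp only [ih]

theorem Term.HasSort.rename {srt : X → S.Srt} {srt' : Y → S.Srt} {π : X → Y}
    (hπ : ∀ x, srt' (π x) = srt x) {t : Term S X} {s : S.Srt} (h : t.HasSort srt s) :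
    (t.rename π).HasSort srt' s := by
  induction h with
  | var x s h => exact .var _ _ (by rwa [hπ])
  | elem b a s h => exact .elem _ _ _ h
  | bapp f ts s _ h ih => exact .bapp _ _ _ ih h
  | capp f n ts w s' s hr _ h ih => exact .capp _ _ _ w s' _ hr ih h

theorem Val.HasSort.mono {v : Val S} {s s' : S.Srt} (h : v.HasSort s) (hs : S.le s s') :
    v.HasSort s' := by
  cases h with
  | elem b a _ h => exact .elem _ _ _ (S.le_trans _ _ _ h hs)
  | app f n vs w s₁ _ hr hv h => exact .app _ _ _ w s₁ _ hr hv (S.le_trans _ _ _ h hs)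

theorem Val.HasSort.exists_elem {v : Val S} {b : S.BSort} (h : v.HasSort (Sum.inl b)) :
    ∃ a, v = .elem b a := by
  cases h with
  | elem b' a _ h =>
    obtain rfl : b' = b := Sum.inl.inj (S.le_builtin _ _ h)
    exact ⟨a, rfl⟩
  | app f n vs w s' _ hr hv h => exact absurd (S.le_builtin _ _ h) (by simp)

theorem Term.HasSort.eval {srt : X → S.Srt} {α : X → Val S} (hα : ∀ x, (α x).HasSort (srt x))
    {t : Term S X} {s : S.Srt} (h : t.HasSort srt s) : (t.eval α).HasSort s := by
  induction h with
  | var x s h => exact (hα x).mono h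
  | elem b a s h => exact .elem _ _ _ h
  | bapp f ts s _ h ih =>
    -- Well-sorted arguments of a builtin symbol are builtin elements, because no other sort lies
    -- below a builtin one; so `bopVal` does not fall back on its default value.
    have key : ∃ a : (i : Fin (S.bArity f)) → S.carrier (S.bDom f i),
        ∀ i, (ts i).eval α = Val.elem (S.bDom f i) (a i) := by
      choose a ha using fun i => (ih i).exists_elem
      exact ⟨a, ha⟩
    rw [Term.eval, bopVal, dif_pos key]
    exact .elem _ _ _ h
  | capp f n ts w s' s hr _ h ih => exact .app _ _ _ w s' _ hr ih h

theorem Term.eval_plug (c : Ctx S) (t : Term S S.V) (α : S.V → Val S) :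
    (c.plug t).eval α = c.eval fun o => o.elim (t.eval α) α := by
  rw [Term.plug, Term.eval_subst]
  congr 1
  funext o
  cases o <;> rfl

theorem Term.eval_plug_rename (π : S.V → S.V) (c : Ctx S) (t : Term S S.V) (α : S.V → Val S) :
    ((c.rename (Option.map π)).plug (t.rename π)).eval α = (c.plug t).eval (α ∘ π) := by
  rw [Term.eval_plug, Term.eval_plug, Term.eval_rename, Term.eval_rename]
  congr 1
  funext o
  cases o <;> rfl

theorem Term.eval_substCtx (θ : S.V → Term S S.V) (c : Ctx S) (v : Val S) (α : S.V → Val S) :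
    (c.substCtx θ).eval (fun o => o.elim v α) =
      c.eval fun o => o.elim v fun x => (θ x).eval α := by
  rw [Term.substCtx, Term.eval_subst]
  congr 1
  funext o
  cases o with
  | none => rfl
  | some x => exact Term.eval_rename _ _ _

/-! ### Formulas -/

open Classical in
theorem Formula.sat_congr {φ : Formula S} {α β : S.V → Val S} (h : ∀ x ∈ φ.fv, α x = β x) :
    φ.Sat α ↔ φ.Sat β := by
  induction φ generalizing α β with
  | bot => exact Iff.rfl
  | eq t t' =>
    simp only [Formula.Sat, t.eval_congr fun x hx => h x (.inl hx),
      t'.eval_congr fun x hx => h x (.inr hx)]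
  | atom t => simp only [Formula.Sat, t.eval_congr h]
  | neg φ ih => exact not_congr (ih h)
  | and φ ψ ih₁ ih₂ =>
    exact and_congr (ih₁ fun x hx => h x (.inl hx)) (ih₂ fun x hx => h x (.inr hx))
  | or φ ψ ih₁ ih₂ =>
    exact or_congr (ih₁ fun x hx => h x (.inl hx)) (ih₂ fun x hx => h x (.inr hx))
  | imp φ ψ ih₁ ih₂ =>
    exact imp_congr (ih₁ fun x hx => h x (.inl hx)) (ih₂ fun x hx => h x (.inr hx))
  | all y φ ih =>
    refine forall_congr' fun v => imp_congr_right fun _ => ih fun x hx => ?_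
    by_cases hxy : x = y
    · subst hxy; simp
    · simpa [Function.update_of_ne hxy] using h x ⟨hx, hxy⟩
  | ex y φ ih =>
    refine exists_congr fun v => and_congr_right fun _ => ih fun x hx => ?_
    by_cases hxy : x = y
    · subst hxy; simp
    · simpa [Function.update_of_ne hxy] using h x ⟨hx, hxy⟩

open Classical in
-- At a quantifier, injectivity of `π` lets the update pass through the renaming, and preservation
-- of sorts keeps the range of quantification.
theorem Formula.sat_rename {π : Equiv.Perm S.V} (hπ : SortPreserving π) (φ : Formula S)
    (α : S.V → Val S) : (φ.rename π).Sat α ↔ φ.Sat (α ∘ π) := by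
  induction φ generalizing α with
  | bot => exact Iff.rfl
  | eq t t' => simp only [Formula.rename, Formula.Sat, Term.eval_rename]
  | atom t => simp only [Formula.rename, Formula.Sat, Term.eval_rename]
  | neg φ ih => exact not_congr (ih α)
  | and φ ψ ih₁ ih₂ => exact and_congr (ih₁ α) (ih₂ α)
  | or φ ψ ih₁ ih₂ => exact or_congr (ih₁ α) (ih₂ α)
  | imp φ ψ ih₁ ih₂ => exact imp_congr (ih₁ α) (ih₂ α)
  | all x φ ih =>
    simp only [Formula.rename, Formula.Sat, ih, hπ x,
      Function.update_comp_eq_of_injective _ π.injective]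
  | ex x φ ih =>
    simp only [Formula.rename, Formula.Sat, ih, hπ x,
      Function.update_comp_eq_of_injective _ π.injective]

theorem Formula.fv_rename (π : Equiv.Perm S.V) (φ : Formula S) :
    (φ.rename π).fv = π '' φ.fv := by
  induction φ with
  | bot => simp [Formula.rename, Formula.fv]
  | eq t t' => simp only [Formula.rename, Formula.fv, Term.vars_rename, Set.image_union]
  | atom t => simp only [Formula.rename, Formula.fv, Term.vars_rename]
  | neg φ ih => exact ih
  | and φ ψ ih₁ ih₂ => simp only [Formula.rename, Formula.fv, ih₁, ih₂, Set.image_union]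
  | or φ ψ ih₁ ih₂ => simp only [Formula.rename, Formula.fv, ih₁, ih₂, Set.image_union]
  | imp φ ψ ih₁ ih₂ => simp only [Formula.rename, Formula.fv, ih₁, ih₂, Set.image_union]
  | all x φ ih =>
    simp only [Formula.rename, Formula.fv, ih, Set.image_sdiff π.injective, Set.image_singleton]
  | ex x φ ih =>
    simp only [Formula.rename, Formula.fv, ih, Set.image_sdiff π.injective, Set.image_singleton]

theorem Formula.finite_fv (φ : Formula S) : φ.fv.Finite := by
  induction φ with
  | bot => exact Set.finite_empty
  | eq t t' => exact t.finite_vars.union t'.finite_vars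
  | atom t => exact t.finite_vars
  | neg φ ih => exact ih
  | and φ ψ ih₁ ih₂ => exact ih₁.union ih₂
  | or φ ψ ih₁ ih₂ => exact ih₁.union ih₂
  | imp φ ψ ih₁ ih₂ => exact ih₁.union ih₂
  | all x φ ih => exact ih.sdiff
  | ex x φ ih => exact ih.sdiff

theorem Formula.fv_exs (xs : List S.V) (φ : Formula S) :
    (Formula.exs xs φ).fv = φ.fv \ {x | x ∈ xs} := by
  induction xs with
  | nil => simp [Formula.exs]
  | cons x xs ih =>
    change (Formula.exs xs φ).fv \ {x} = _
    rw [ih]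
    ext y
    simp only [Set.mem_sdiff, Set.mem_ofPred_eq, Set.mem_singleton_iff, List.mem_cons]
    tauto

theorem IsValuation.update {α : S.V → Val S} (hα : IsValuation α) {x : S.V} {v : Val S}
    [DecidableEq S.V] (hv : v.HasSort (S.sortOf x)) : IsValuation (Function.update α x v) := by
  intro y
  by_cases h : y = x
  · subst h; simpa using hv
  · simpa [Function.update_of_ne h] using hα y

open Classical in
theorem Formula.Sat.of_exs {xs : List S.V} {φ : Formula S} {α : S.V → Val S}
    (hα : IsValuation α) (h : (Formula.exs xs φ).Sat α) :
    ∃ β, IsValuation β ∧ (∀ x ∉ xs, β x = α x) ∧ φ.Sat β := by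
  induction xs generalizing α with
  | nil => exact ⟨α, hα, fun _ _ => rfl, h⟩
  | cons x xs ih =>
    obtain ⟨v, hv, h⟩ := h
    obtain ⟨β, hβ, hβα, hs⟩ := ih (hα.update hv) h
    refine ⟨β, hβ, fun y hy => ?_, hs⟩
    rw [List.mem_cons, not_or] at hy
    rw [hβα y hy.2, Function.update_of_ne hy.1]

/-! ### Renamings -/

theorem IsValuation.comp {α : S.V → Val S} (hα : IsValuation α) {π : Equiv.Perm S.V}
    (hπ : SortPreserving π) : IsValuation (α ∘ π) := fun x => hπ x ▸ hα (π x)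

theorem SortPreserving.symm {π : Equiv.Perm S.V} (hπ : SortPreserving π) :
    SortPreserving π.symm := fun x => by simpa using (hπ (π.symm x)).symm

theorem exists_fresh_var (s : S.Srt) {F : Set S.V} (hF : F.Finite) :
    ∃ x, S.sortOf x = s ∧ x ∉ F := by
  have hi : {x : S.V | S.sortOf x = s}.Infinite := Set.infinite_coe_iff.1 (S.infinite_vars s)
  obtain ⟨x, hx, hxF⟩ := (hi.sdiff hF).nonempty
  exact ⟨x, hx, hxF⟩

theorem exists_fresh_renaming {A F : Set S.V} (hA : A.Finite) (hF : F.Finite) :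
    ∃ π : Equiv.Perm S.V, SortPreserving π ∧ Disjoint (π '' A) F := by
  classical
  induction A, hA using Set.Finite.induction_on with
  | empty => exact ⟨1, fun _ => rfl, by simp⟩
  | @insert a A ha hA ih =>
    obtain ⟨π, hπ, hd⟩ := ih
    -- Since `b` also avoids `π '' A`, swapping `π a` with `b` after `π` leaves the images of the
    -- earlier variables in place.
    obtain ⟨b, hb, hbF⟩ := exists_fresh_var (S.sortOf a) (hF.union (hA.image π))
    rw [Set.mem_union, not_or] at hbF
    refine ⟨π.trans (Equiv.swap (π a) b), fun x => ?_, ?_⟩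
    · rw [Equiv.trans_apply, ← hπ x, Equiv.swap_apply_def]
      split_ifs with h₁ h₂
      · rw [h₁, hb, hπ]
      · rw [h₂, hb, hπ]
      · rfl
    · rw [Set.disjoint_left] at hd ⊢
      rintro _ ⟨x, rfl | hx, rfl⟩
      · simpa using hbF.1
      · have h₁ : π x ≠ π a := fun h => ha (π.injective h ▸ hx)
        have h₂ : π x ≠ b := fun h => hbF.2 ⟨x, hx, h⟩
        rw [Equiv.trans_apply, Equiv.swap_apply_of_ne_of_ne h₁ h₂]
        exact hd ⟨x, hx, rfl⟩

theorem Rule.FitsIn.rename {ρ : Rule S} {c : Ctx S} (h : ρ.FitsIn c) {π : Equiv.Perm S.V}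
    (hπ : SortPreserving π) : ρ.FitsIn (c.rename (Option.map π)) := by
  obtain ⟨s, hl, hr, ho, s', hs'⟩ := h
  refine ⟨s, hl, hr, ?_, s', hs'.rename fun o => ?_⟩
  · exact (Term.occ_rename (Option.map_injective π.injective) none c).trans ho
  · cases o with
    | none => rfl
    | some x => exact hπ x

theorem CTerm.finite_vars (φ : CTerm S) : φ.vars.Finite :=
  φ.term.finite_vars.union φ.form.finite_fv

theorem Rule.finite_vars (ρ : Rule S) : ρ.vars.Finite :=
  (ρ.lhs.finite_vars.union ρ.rhs.finite_vars).union ρ.cond.finite_fv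

/-! ### Instances of reachability formulas -/

/-- Fixing more variables leaves fewer valuations. A premise can share more variables with the
right-hand side than its conclusion does, and then aims at a smaller target; this is why
`RForm.Covers` allows a subset. -/
theorem CTerm.sem_anti (φ : CTerm S) {A B : Set S.V} {σ τ : S.V → Val S} (hAB : A ⊆ B)
    (h : ∀ x ∈ A, τ x = σ x) : φ.sem B τ ⊆ φ.sem A σ := by
  rintro γ ⟨α, hα, hατ, hs, rfl⟩
  exact ⟨α, hα, fun x hx => (hατ x (hAB hx)).trans (h x hx), hs, rfl⟩

theorem RForm.mem_instances_of_sat (f : RForm S) {α : S.V → Val S} (hα : IsValuation α)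
    (hs : f.lhs.form.Sat α) : (f.lhs.term.eval α, f.rhs.sem f.shared α) ∈ f.instances :=
  ⟨α, hα, ⟨α, hα, fun _ _ => rfl, hs, rfl⟩, rfl⟩

/-- The valuation witnessing `γ` agrees with the instantiation on the shared variables, so it can
serve as the instantiation too. -/
theorem RForm.exists_of_mem_instances {f : RForm S} {γ : Val S} {Q : Set (Val S)}
    (h : (γ, Q) ∈ f.instances) : ∃ α, IsValuation α ∧ f.lhs.form.Sat α ∧
      γ = f.lhs.term.eval α ∧ Q = f.rhs.sem f.shared α := by
  obtain ⟨σ, -, ⟨α, hα, hασ, hs, hγ⟩, hQ⟩ := h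
  refine ⟨α, hα, hs, hγ, hQ.trans (Set.Subset.antisymm ?_ ?_)⟩
  · exact f.rhs.sem_anti subset_rfl fun x hx => (hασ x hx).symm
  · exact f.rhs.sem_anti subset_rfl hασ

/-- `f.Covers γ Q`: some instance of `f` requires that `Q`, or a subset of it, be reached
from `γ`. -/
def RForm.Covers (f : RForm S) (γ : Val S) (Q : Set (Val S)) : Prop :=
  ∃ Q' ⊆ Q, (γ, Q') ∈ f.instances

/-- If a premise has the right-hand side of the conclusion and at least the variables of its
left-hand side, then its instances cover the requirements of the conclusion. -/
theorem RForm.covers_of_sat {f p : RForm S} (hrhs : p.rhs = f.rhs) (hvars : f.lhs.vars ⊆ p.lhs.vars)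
    {α β : S.V → Val S} (hβ : IsValuation β) (hβα : ∀ x ∈ f.lhs.vars, β x = α x)
    (hs : p.lhs.form.Sat β) : p.Covers (p.lhs.term.eval β) (f.rhs.sem f.shared α) := by
  refine ⟨_, ?_, p.mem_instances_of_sat hβ hs⟩
  rw [hrhs]
  refine f.rhs.sem_anti (fun x hx => ⟨hvars hx.1, ?_⟩) fun x hx => hβα x hx.1
  rw [hrhs]
  exact hx.2

/-! ### Soundness of the single proof rules -/

theorem DerData.exists_trans {R : Set (Rule S)} {φ : CTerm S} {d : DerData S} (hd : IsDer R φ d)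
    {β : S.V → Val S} (hβ : IsValuation β) (hs : (d.form φ).Sat β) :
    Trans R (φ.term.eval β) (d.term.eval β) := by
  obtain ⟨hR, hren, -, hfits, -⟩ := hd
  obtain ⟨-, heq, hcond⟩ := hs
  -- A transition uses the unrenamed rule, so the renaming is moved into the valuation and undone in
  -- the context.
  have key (t : Term S S.V) : ((d.ctx.rename (Option.map d.ren.symm)).plug t).eval (β ∘ d.ren) =
      (d.ctx.plug (t.rename d.ren)).eval β := by
    rw [Term.eval_plug, Term.eval_plug, Term.eval_rename, Term.eval_rename]
    congr 1
    funext o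
    cases o <;> simp
  refine ⟨d.rule, hR, _, hfits.rename hren.symm, β ∘ d.ren, hβ.comp hren,
    (Formula.sat_rename hren _ _).1 hcond, ?_, ?_⟩
  · rw [key]; exact heq
  · rw [key]; rfl

open Classical in
-- Completeness of derivatives: once rule and context are renamed apart from `φ`, the valuation of
-- the term and that of the transition merge into one, which satisfies the constraint of the
-- derivative.
theorem exists_isDer_of_trans {R : Set (Rule S)} {φ : CTerm S} {α : S.V → Val S}
    (hα : IsValuation α) (hs : φ.form.Sat α) {γ' : Val S} (ht : Trans R (φ.term.eval α) γ') :
    ∃ d, IsDer R φ d ∧ ∃ β, IsValuation β ∧ (∀ x ∈ φ.vars, β x = α x) ∧ (d.form φ).Sat β ∧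
      d.term.eval β = γ' := by
  obtain ⟨ρ, hρ, c, hfits, α₁, hα₁, hcond, hl, rfl⟩ := ht
  -- The context has variables of its own, valued by `α₁`; they must be made fresh together with
  -- those of the rule.
  have hfin : (ρ.vars ∪ some ⁻¹' c.vars).Finite :=
    ρ.finite_vars.union (c.finite_vars.preimage (Option.some_injective _).injOn)
  obtain ⟨π, hπ, hdisj⟩ := exists_fresh_renaming hfin φ.finite_vars
  rw [Set.image_union, Set.disjoint_union_left] at hdisj
  let β : S.V → Val S := fun x => if x ∈ φ.vars then α x else α₁ (π.symm x)
  have hβ : IsValuation β := by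
    intro x
    by_cases hx : x ∈ φ.vars
    · simpa [β, hx] using hα x
    · simpa [β, hx] using hα₁.comp hπ.symm x
  have hβα : ∀ x ∈ φ.vars, β x = α x := fun x hx => if_pos hx
  have hβρ : ∀ x ∈ ρ.vars, (β ∘ π) x = α₁ x := fun x hx => by
    have : π x ∉ φ.vars := Set.disjoint_left.1 hdisj.1 ⟨x, hx, rfl⟩
    simp [β, this]
  have hβc : ∀ x, some x ∈ c.vars → (β ∘ π) x = α₁ x := fun x hx => by
    have : π x ∉ φ.vars := Set.disjoint_left.1 hdisj.2 ⟨x, hx, rfl⟩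
    simp [β, this]
  have key (t : Term S S.V) (ht : t.vars ⊆ ρ.vars) :
      ((c.rename (Option.map π)).plug (t.rename π)).eval β = (c.plug t).eval α₁ := by
    rw [Term.eval_plug_rename, Term.eval_plug, Term.eval_plug]
    refine c.eval_congr fun o ho => ?_
    cases o with
    | none => exact t.eval_congr fun x hx => hβρ x (ht hx)
    | some x => exact hβc x ho
  have hsat : (DerData.form ⟨ρ, π, c.rename (Option.map π)⟩ φ).Sat β := by
    refine ⟨(Formula.sat_congr fun x hx => hβα x (.inr hx)).2 hs, ?_, ?_⟩
    · change φ.term.eval β = ((c.rename (Option.map π)).plug (ρ.lhs.rename π)).eval β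
      rw [key ρ.lhs fun x hx => .inl (.inl hx), ← hl]
      exact φ.term.eval_congr fun x hx => hβα x (.inl hx)
    · exact (Formula.sat_rename hπ _ _).2
        ((Formula.sat_congr fun x hx => hβρ x (.inr hx)).2 hcond)
  exact ⟨⟨ρ, π, c.rename (Option.map π)⟩, ⟨hρ, hπ, hdisj.1, hfits.rename hπ, β, hβ, hsat⟩,
    β, hβ, hβα, hsat, key ρ.rhs fun x hx => .inl (.inr hx)⟩

/-- Pulling the valuation back along the substitution `θ` turns a solution for the instance into one
for the representative with the same resulting state. Hence premises for representatives suffice. -/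
theorem IsInstance.exists_valuation {R : Set (Rule S)} {φ : CTerm S} {d d' : DerData S}
    (h : IsInstance φ d d') (hd : IsDer R φ d) (hd' : IsDer R φ d') {β : S.V → Val S}
    (hβ : IsValuation β) (hs : (d'.form φ).Sat β) :
    ∃ β', IsValuation β' ∧ (∀ x ∈ φ.vars, β' x = β x) ∧ (d.form φ).Sat β' ∧
      d.term.eval β' = d'.term.eval β := by
  obtain ⟨hrule, θ, hθ, hfix, hctx, hren⟩ := h
  obtain ⟨hφ, heq, hcond⟩ := hs
  let β' : S.V → Val S := fun x => (θ x).eval β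
  have hβ'φ : ∀ x ∈ φ.vars, β' x = β x := fun x hx => by simp only [β', hfix x hx, Term.eval]
  have hβ'ρ : ∀ x ∈ d.rule.vars, (β' ∘ d.ren) x = (β ∘ d'.ren) x := fun x hx => by
    simp only [β', Function.comp, hren x hx, Term.eval]
  have key (t : Term S S.V) (ht : t.vars ⊆ d.rule.vars) :
      (d.ctx.plug (t.rename d.ren)).eval β' = (d'.ctx.plug (t.rename d'.ren)).eval β := by
    rw [hctx, Term.eval_plug, Term.eval_plug, Term.eval_substCtx, Term.eval_rename,
      Term.eval_rename, t.eval_congr fun x hx => hβ'ρ x (ht hx)]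
  refine ⟨β', fun x => (hθ x).eval hβ, hβ'φ, ⟨?_, ?_, ?_⟩, ?_⟩
  · exact (Formula.sat_congr fun x hx => hβ'φ x (.inr hx)).2 hφ
  · change φ.term.eval β' = (d.ctx.plug (d.rule.lhs.rename d.ren)).eval β'
    rw [key d.rule.lhs fun x hx => .inl (.inl hx), ← hrule,
      φ.term.eval_congr fun x hx => hβ'φ x (.inl hx)]
    exact heq
  · refine (Formula.sat_rename hd.2.1 _ _).2
      ((Formula.sat_congr fun x hx => hβ'ρ x (.inr hx)).2 ?_)
    rw [← hrule]
    exact (Formula.sat_rename hd'.2.1 _ _).1 hcond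
  · rw [DerData.term, DerData.term, key d.rule.rhs fun x hx => .inl (.inr hx), hrule]

theorem Inference.sound_subs {f p : RForm S} {xs : List S.V}
    {ψ : Formula S} (hxs : ∀ x, x ∈ xs ↔ x ∈ f.rhs.vars \ f.lhs.vars)
    (hψ : ψ = .exs xs (.and (.eq f.lhs.term f.rhs.term) f.rhs.form))
    (hterm : p.lhs.term = f.lhs.term) (hform : p.lhs.form = .and f.lhs.form (.neg ψ))
    (hrhs : p.rhs = f.rhs) {γ : Val S} {Q : Set (Val S)} (h : (γ, Q) ∈ f.instances) :
    γ ∈ Q ∨ p.Covers γ Q := by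
  obtain ⟨α, hα, hs, rfl, rfl⟩ := RForm.exists_of_mem_instances h
  by_cases hαψ : ψ.Sat α
  · left
    rw [hψ] at hαψ
    obtain ⟨β, hβ, hβα, heq, hr⟩ := hαψ.of_exs hα
    have hl : ∀ x ∈ f.lhs.vars, β x = α x := fun x hx => hβα x fun hx' => ((hxs x).1 hx').2 hx
    refine ⟨β, hβ, fun x hx => hl x hx.1, hr, ?_⟩
    rw [← f.lhs.term.eval_congr fun x hx => hl x (.inl hx)]
    exact heq
  · right
    rw [← hterm]
    refine RForm.covers_of_sat hrhs ?_ hα (fun _ _ => rfl) ?_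
    · rintro x (hx | hx)
      · exact .inl (hterm ▸ hx)
      · exact .inr (hform ▸ .inl hx)
    · rw [hform]; exact ⟨hs, hαψ⟩

theorem Inference.sound_der {R : Set (Rule S)} {f : RForm S} {D : Set (DerData S)}
    {Ps : Set (RForm S)} (hD : IsDerSet R f.lhs D)
    (htotal : ∀ α, IsValuation α → f.lhs.form.Sat α → ∃ d ∈ D, ∃ β, IsValuation β ∧
      (∀ x, x ∉ (d.term.vars ∪ (d.form f.lhs).fv) \ f.lhs.vars → β x = α x) ∧
      (d.form f.lhs).Sat β)
    (hprem : ∀ d ∈ D, ∃ p ∈ Ps, p.lhs.term = d.term ∧ p.lhs.form = d.form f.lhs ∧ p.rhs = f.rhs)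
    {γ : Val S} {Q : Set (Val S)} (h : (γ, Q) ∈ f.instances) :
    (∃ γ', Trans R γ γ') ∧ ∀ γ', Trans R γ γ' → ∃ p ∈ Ps, p.Covers γ' Q := by
  obtain ⟨α, hα, hs, rfl, rfl⟩ := RForm.exists_of_mem_instances h
  constructor
  · obtain ⟨d, hd, β, hβ, hβα, hds⟩ := htotal α hα hs
    refine ⟨d.term.eval β, ?_⟩
    rw [f.lhs.term.eval_congr fun x hx => (hβα x fun hx' => hx'.2 (.inl hx)).symm]
    exact DerData.exists_trans (hD.1 d hd) hβ hds
  · intro γ' ht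
    obtain ⟨d', hd', β, hβ, hβα, hds, rfl⟩ := exists_isDer_of_trans hα hs ht
    obtain ⟨d, hd, hinst⟩ := hD.2 d' hd'
    obtain ⟨β', hβ', hβ'β, hds', hγ⟩ := hinst.exists_valuation (hD.1 d hd) hd' hβ hds
    obtain ⟨p, hp, hterm, hform, hrhs⟩ := hprem d hd
    refine ⟨p, hp, ?_⟩
    rw [← hγ, ← hterm]
    refine RForm.covers_of_sat hrhs ?_ hβ' (fun x hx => (hβ'β x hx).trans (hβα x hx)) ?_
    -- The term of a derivative may lose variables of `t_l`, but the equation `t_l = c[l]` keeps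
    -- them in its constraint.
    · rintro x (hx | hx)
      · exact .inr (hform ▸ .inr (.inl (.inl hx)))
      · exact .inr (hform ▸ .inl hx)
    · rw [hform]; exact hds'

open Classical in
theorem Inference.sound_circ {f p q g : RForm S} {π : Equiv.Perm S.V} {xs : List S.V}
    {ψ : Formula S} (hπ : SortPreserving π) (hfresh : Disjoint (π '' g.vars) f.vars)
    (hxs : ∀ x, x ∈ xs ↔ x ∈ π '' g.lhs.vars)
    (hψ : ψ = .exs xs (.and (.eq f.lhs.term (g.lhs.term.rename π)) (g.lhs.form.rename π)))
    (hpterm : p.lhs.term = g.rhs.term.rename π)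
    (hpform : p.lhs.form = .and f.lhs.form (.and ψ (g.rhs.form.rename π)))
    (hprhs : p.rhs = f.rhs) (hqterm : q.lhs.term = f.lhs.term)
    (hqform : q.lhs.form = .and f.lhs.form (.neg ψ)) (hqrhs : q.rhs = f.rhs)
    {γ : Val S} {Q : Set (Val S)} (h : (γ, Q) ∈ f.instances) :
    (∃ Q₁, (γ, Q₁) ∈ g.instances ∧ ∀ δ ∈ Q₁, p.Covers δ Q) ∨ q.Covers γ Q := by
  obtain ⟨α, hα, hs, rfl, rfl⟩ := RForm.exists_of_mem_instances h
  -- All variables of the circularity's left side are bound in `ψ`, and freshness keeps them out of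
  -- `t_l`. So the truth of `ψ` depends on `t_l` alone, and `ψ` keeps these variables in the first
  -- premise.
  have hfv : ψ.fv = f.lhs.term.vars := by
    rw [hψ, Formula.fv_exs]
    simp only [Formula.fv, Term.vars_rename, Formula.fv_rename]
    ext x
    simp only [Set.mem_sdiff, Set.mem_union, Set.mem_ofPred_eq, hxs, CTerm.vars, Set.image_union]
    have : x ∈ f.lhs.term.vars → ¬ (x ∈ π '' g.lhs.term.vars ∨ x ∈ π '' g.lhs.form.fv) := by
      rw [← Set.mem_union, ← Set.image_union]
      exact fun hx hx' => Set.disjoint_left.1 hfresh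
        (Set.image_mono Set.subset_union_left hx') (.inl (.inl hx))
    tauto
  by_cases hαψ : ψ.Sat α
  · left
    have hαψ' := hαψ
    rw [hψ] at hαψ'
    obtain ⟨α', hα', hα'α, heq, hl⟩ := hαψ'.of_exs hα
    refine ⟨g.rhs.sem g.shared (α' ∘ π), ?_, ?_⟩
    · have hγ : f.lhs.term.eval α = g.lhs.term.eval (α' ∘ π) := by
        rw [← Term.eval_rename, f.lhs.term.eval_congr fun x hx => (hα'α x fun hx' => ?_).symm]
        · exact heq
        · exact Set.disjoint_left.1 hfresh
            (Set.image_mono Set.subset_union_left ((hxs x).1 hx')) (.inl (.inl hx))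
      rw [hγ]
      exact g.mem_instances_of_sat (hα'.comp hπ) ((Formula.sat_rename hπ _ _).1 hl)
    -- Agreement of `β` with the matching valuation can be dropped: `ψ` binds the variables of the
    -- left side of `g`, so the premise does not tie their occurrences on the right to the match.
    · rintro _ ⟨β, hβ, -, hβs, rfl⟩
      let τ : S.V → Val S := fun x => if x ∈ π '' g.vars then β (π.symm x) else α x
      have hτ : IsValuation τ := by
        intro x
        by_cases hx : x ∈ π '' g.vars
        · simpa only [τ, if_pos hx, Function.comp] using hβ.comp hπ.symm x
        · simpa only [τ, if_neg hx] using hα x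
      have hτf : ∀ x ∈ f.lhs.vars, τ x = α x := fun x hx =>
        if_neg fun hx' => Set.disjoint_left.1 hfresh hx' (.inl hx)
      have hτg : ∀ x ∈ g.rhs.vars, (τ ∘ π) x = β x := fun x hx => by
        have : π x ∈ π '' g.vars := ⟨x, .inr hx, rfl⟩
        simp only [τ, Function.comp, if_pos this, Equiv.symm_apply_apply]
      have hγ : g.rhs.term.eval β = p.lhs.term.eval τ := by
        rw [hpterm, Term.eval_rename, g.rhs.term.eval_congr fun x hx => hτg x (.inl hx)]
      rw [hγ]
      refine RForm.covers_of_sat hprhs ?_ hτ hτf ?_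
      · rintro x (hx | hx)
        · exact .inr (hpform ▸ .inr (.inl (hfv ▸ hx)))
        · exact .inr (hpform ▸ .inl hx)
      · rw [hpform]
        refine ⟨(Formula.sat_congr fun x hx => hτf x (.inr hx)).2 hs,
          (Formula.sat_congr fun x hx => hτf x (.inl (hfv ▸ hx))).2 hαψ,
          (Formula.sat_rename hπ _ _).2
            ((Formula.sat_congr fun x hx => hτg x (.inr hx)).2 hβs)⟩
  · right
    rw [← hqterm]
    refine RForm.covers_of_sat hqrhs ?_ hα (fun _ _ => rfl) ?_
    · rintro x (hx | hx)
      · exact .inl (hqterm ▸ hx)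
      · exact .inr (hqform ▸ .inl hx)
    · rw [hqform]; exact ⟨hs, hαψ⟩

/-- What a proof rule says about an instance `(γ, Q)` of its conclusion. -/
theorem Inference.sound {R : Set (Rule S)} {G : Set (RForm S)} {k : Kind} {f : RForm S}
    {Ps : Set (RForm S)} (hi : Inference R G k f Ps) {γ : Val S} {Q : Set (Val S)}
    (h : (γ, Q) ∈ f.instances) :
    γ ∈ Q ∨ (k ≠ .der ∧ ∃ p ∈ Ps, p.Covers γ Q) ∨
      (k = .circ ∧ ∃ g ∈ G, ∃ Q₁, (γ, Q₁) ∈ g.instances ∧ ∃ p ∈ Ps, ∀ δ ∈ Q₁, p.Covers δ Q) ∨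
      ((∃ γ', Trans R γ γ') ∧ ∀ γ', Trans R γ γ' → ∃ p ∈ Ps, p.Covers γ' Q) := by
  cases hi with
  | ax _ hbot =>
    obtain ⟨α, -, hs, -⟩ := RForm.exists_of_mem_instances h
    rw [hbot] at hs
    exact hs.elim
  | subs _ p xs ψ hxs hψ hsat hterm hform hrhs =>
    rcases Inference.sound_subs hxs hψ hterm hform hrhs h with h | h
    · exact .inl h
    · exact .inr (.inl ⟨by simp, p, rfl, h⟩)
  | der _ D _ hD hder htotal hprem honly =>
    exact .inr (.inr (.inr (Inference.sound_der hD htotal hprem h)))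
  | circ _ p q g π xs ψ hg hπ hfresh hxs hψ hpterm hpform hprhs hqterm hqform hqrhs =>
    rcases Inference.sound_circ hπ hfresh hxs hψ hpterm hpform hprhs hqterm hqform hqrhs h with
      ⟨Q₁, h₁, h₂⟩ | h
    · exact .inr (.inr (.inl ⟨rfl, g, hg, Q₁, h₁, p, .inl rfl, h₂⟩))
    · exact .inr (.inl ⟨by simp, q, .inr rfl, h⟩)

/-! ### Coinduction up to transitivity -/

section Closure

variable {M : Type u}

/-- The closure of a set of pointwise reachability requirements under reflexivity and
transitivity. -/
inductive ReachClosure (B : Set (M × Set M)) : M → Set M → Prop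
  | done {γ : M} {Q : Set M} (h : γ ∈ Q) : ReachClosure B γ Q
  | base {γ : M} {Q : Set M} (h : (γ, Q) ∈ B) : ReachClosure B γ Q
  | trans {γ : M} {Q Q' : Set M} (h : ReachClosure B γ Q') (h' : ∀ δ ∈ Q', ReachClosure B δ Q) :
      ReachClosure B γ Q

/-- One step towards `Q` from `γ`: either `γ ∈ Q`, or `γ` has successors, all of which lie
in `C`. -/
def Advances (tr : M → M → Prop) (C : Set M) (γ : M) (Q : Set M) : Prop :=
  γ ∈ Q ∨ ((∃ γ', tr γ γ') ∧ ∀ γ', tr γ γ' → γ' ∈ C)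

variable {tr : M → M → Prop} {B : Set (M × Set M)}

theorem ReachClosure.mono {γ : M} {Q Q' : Set M} (h : ReachClosure B γ Q') (hQ : Q' ⊆ Q) :
    ReachClosure B γ Q :=
  h.trans fun _ hδ => .done (hQ hδ)

/-- A step towards `Q'` is also a step towards `Q`. Only when `γ` is already in `Q'`, so that no
step was made, must `γ` advance by other means. -/
theorem Advances.trans {γ : M} {Q Q' : Set M}
    (h : Advances tr {δ | ReachClosure B δ Q'} γ Q')
    (h' : ∀ δ ∈ Q', ReachClosure B δ Q) (hγ : γ ∈ Q' → Advances tr {δ | ReachClosure B δ Q} γ Q) :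
    Advances tr {δ | ReachClosure B δ Q} γ Q := by
  rcases h with h | ⟨h₁, h₂⟩
  · exact hγ h
  · exact .inr ⟨h₁, fun γ' ht => (h₂ γ' ht).trans h'⟩

theorem ReachClosure.advances
    (hB : ∀ γ Q, (γ, Q) ∈ B → Advances tr {δ | ReachClosure B δ Q} γ Q)
    {γ : M} {Q : Set M} (h : ReachClosure B γ Q) :
    Advances tr {δ | ReachClosure B δ Q} γ Q := by
  induction h with
  | done h => exact .inl h
  | base h => exact hB _ _ h
  | trans _ h' ih ih' => exact ih.trans h' (ih' _)

theorem demonicallyValid_of_advances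
    (hB : ∀ γ Q, (γ, Q) ∈ B → Advances tr {δ | ReachClosure B δ Q} γ Q)
    {P Q : Set M} (h : ∀ γ ∈ P, ReachClosure B γ Q) : DemonicallyValid tr P Q := by
  -- Coinduction: the candidate relates `P` to `Q` when every state of `P` must reach `Q` according
  -- to the closure.
  have hpost : {p : Set M × Set M | ∀ γ ∈ p.1, ReachClosure B γ p.2} ≤
      dvp tr {p | ∀ γ ∈ p.1, ReachClosure B γ p.2} := by
    rintro ⟨P, Q⟩ hP
    by_cases hPQ : P ⊆ Q
    · exact .inl hPQ
    · have key : ∀ γ ∈ P \ Q, (∃ γ', tr γ γ') ∧ ∀ γ', tr γ γ' → ReachClosure B γ' Q :=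
        fun γ hγ => ((hP γ hγ.1).advances hB).resolve_left hγ.2
      refine .inr ⟨⟨Set.sdiff_nonempty.2 hPQ, fun γ hγ => (key γ hγ).1⟩, ?_⟩
      rintro γ' ⟨γ, hγ, ht⟩
      exact (key γ hγ).2 γ' ht
  exact OrderHom.le_gfp _ hpost h

end Closure

/-! ### Proof trees -/

namespace ProofTree

variable {R : Set (Rule S)} {G : Set (RForm S)}

/-- A descending chain would be an infinite branch without [der] nodes, against `progress`. -/
theorem wellFounded_child (T : ProofTree.{u, v} R G) :
    WellFounded fun m n => T.child n m ∧ T.kind n ≠ .der := by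
  rw [wellFounded_iff_isEmpty_descending_chain]
  refine ⟨fun ⟨b, hb⟩ => ?_⟩
  obtain ⟨i, -, hi⟩ := T.progress b (fun i => (hb i).1) 0
  exact (hb i).2 hi

/-- The requirements expressed by the nodes of guarded proof trees. -/
def requirements (R : Set (Rule S)) (G : Set (RForm S)) : Set (Val S × Set (Val S)) :=
  {p | ∃ T : ProofTree.{u, v} R G, T.Guarded ∧ ∃ n, p ∈ (T.label n).instances}

theorem reachClosure_of_covers {T : ProofTree.{u, v} R G} (hT : T.Guarded) {n : T.Node} {γ : Val S}
    {Q : Set (Val S)} (h : (T.label n).Covers γ Q) :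
    ReachClosure (requirements.{u, v} R G) γ Q := by
  obtain ⟨Q', hQ, h⟩ := h
  exact ReachClosure.mono (.base ⟨T, hT, n, h⟩) hQ

/-- Induction along the part of a guarded proof tree that precedes the next derivative nodes, given
that the circularities applied there advance. -/
theorem advances_of_circ {T : ProofTree.{u, v} R G} (hT : T.Guarded) (C : T.Node → Prop)
    (hC : ∀ n m, C n → T.child n m → T.kind n ≠ .der → C m)
    (hcirc : ∀ n, C n → T.kind n = .circ → ∀ g ∈ G, ∀ γ Q, (γ, Q) ∈ g.instances →
      Advances (Trans R) {δ | ReachClosure (requirements.{u, v} R G) δ Q} γ Q)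
    (n : T.Node) (hn : C n) {γ : Val S} {Q : Set (Val S)} (h : (T.label n).Covers γ Q) :
    Advances (Trans R) {δ | ReachClosure (requirements.{u, v} R G) δ Q} γ Q := by
  induction n using T.wellFounded_child.induction generalizing γ Q with
  | _ n ih =>
  obtain ⟨Q₀, hQ₀, h⟩ := h
  refine Advances.trans ?_ (fun δ hδ => .done (hQ₀ hδ)) fun hγ => .inl (hQ₀ hγ)
  obtain ⟨f, hf, hi⟩ := T.inference n
  -- Equivalent formulas have the same instances, so the implicit structural rule costs nothing.
  rw [hf] at h
  rcases hi.sound h with h | ⟨hk, _, ⟨m, hm, rfl⟩, h⟩ | ⟨hk, g, hg, Q₁, h₁, _, ⟨m, hm, rfl⟩, h₂⟩ |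
    ⟨h₁, h₂⟩
  · exact .inl h
  · exact ih m ⟨hm, hk⟩ (hC n m hn hm hk) h
  · have hk' : T.kind n ≠ .der := by simp [hk]
    -- If `g` makes a step, the first premise covers its target `Q₁` and transitivity finishes; if
    -- `γ ∈ Q₁`, that premise covers `γ` itself and the induction hypothesis applies.
    exact (hcirc n hn hk g hg γ Q₁ h₁).trans (fun δ hδ => reachClosure_of_covers hT (h₂ δ hδ))
      fun hγ => ih m ⟨hm, hk'⟩ (hC n m hn hm hk') (h₂ γ hγ)
  -- No induction past a step: the children's requirements are in the base of the closure by
  -- definition.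
  · refine .inr ⟨h₁, fun γ' ht => ?_⟩
    obtain ⟨_, ⟨m, -, rfl⟩, h⟩ := h₂ γ' ht
    exact reachClosure_of_covers hT h

/-- The descent is confined to nodes without a [der] proper ancestor. Guardedness excludes [circ]
there, so nothing need be known about `G`. -/
theorem advances_root {T : ProofTree.{u, v} R G} (hT : T.Guarded) {γ : Val S} {Q : Set (Val S)}
    (h : (T.label T.root).Covers γ Q) :
    Advances (Trans R) {δ | ReachClosure (requirements.{u, v} R G) δ Q} γ Q := by
  refine advances_of_circ hT (fun n => ∀ a, Relation.TransGen T.child a n → T.kind a ≠ .der)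
    ?_ ?_ T.root ?_ h
  · intro n m hn hnm hk a ha
    obtain ⟨n', han', hn'm⟩ := Relation.TransGen.tail'_iff.1 ha
    -- By uniqueness of parents, an ancestor of the child is the current node or one of its
    -- ancestors.
    obtain rfl := T.unique_parent _ _ _ hn'm hnm
    rcases Relation.reflTransGen_iff_eq_or_transGen.1 han' with rfl | han'
    · exact hk
    · exact hn a han'
  · intro n hn hk
    obtain ⟨a, ha, hka⟩ := hT n hk
    exact (hn a ha hka).elim
  · intro a ha
    obtain ⟨n, -, hn⟩ := Relation.TransGen.tail'_iff.1 ha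
    exact (T.root_no_parent n hn).elim

/-- Any [circ] node may now occur, since the formula it invokes labels the root of a guarded tree
and advances by `advances_root`. -/
theorem advances_requirements
    (hG : ∀ g ∈ G, ∃ T : ProofTree.{u, v} R G, T.label T.root = g ∧ T.Guarded)
    (γ : Val S) (Q : Set (Val S)) (h : (γ, Q) ∈ requirements.{u, v} R G) :
    Advances (Trans R) {δ | ReachClosure (requirements.{u, v} R G) δ Q} γ Q := by
  obtain ⟨T, hT, n, h⟩ := h
  refine advances_of_circ hT (fun _ => True) (fun _ _ _ _ _ => trivial) ?_ n trivial
    ⟨Q, subset_rfl, h⟩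
  intro _ _ _ g hg γ Q h
  obtain ⟨T', rfl, hT'⟩ := hG g hg
  exact advances_root hT' ⟨Q, subset_rfl, h⟩

end ProofTree

end LCTRS

theorem mainTheorem2 (S : LCTRS.Signature.{u})
    (hne : ∀ s : S.Srt, ∃ v : LCTRS.Val S, v.HasSort s)
    (R : Set (LCTRS.Rule S)) (G : Set (LCTRS.RForm S))
    (hG : ∀ g ∈ G, ∃ T : LCTRS.ProofTree.{u, v} R G, T.label T.root = g ∧ T.Guarded) :
    ∀ g ∈ G, LCTRS.Satisfies R g := by
  intro g hg σ hσ
  obtain ⟨T, rfl, hT⟩ := hG g hg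
  exact LCTRS.demonicallyValid_of_advances (LCTRS.ProofTree.advances_requirements hG)
    fun γ hγ => .base ⟨T, hT, T.root, σ, hσ, hγ, rfl⟩
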